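/- Let $E$ be a (real) Banach lattice. A sequence $(x_n)$ in $E$ is called *uaw-null* if $|x_n|\wedge u\to 0$ weakly for every $u\in E^+$, *un-null* if $\||x_n|\wedge u\|\to 0$ for every $u\in E^+$, and *disjoint* if $|x_m|\wedge|x_n|=0$ whenever $m\ne n$. A linear map $T$ from $E$ to a Banach lattice $F$ is *order weakly compact* if $T([0,x])$ is relatively weakly compact in $F$ for every $x\in E^+$. The Banach lattice $E$ is *order continuous* if every net $x_\alpha\downarrow 0$ in $E$ (decreasing, with infimum $0$) satisfies $\|x_\alpha\|\to 0$. (A) Let $F$ be a Banach lattice and let $T:E\to F$ be a surjective lattice homomorphism (a linear map with $T(x\vee y)=Tx\vee Ty$ for all $x,y\in E$). Then the following are equivalent: 1. $(T(x_n))$ is un-null for every uaw-null sequence $(x_n)$ in $E$. 2. $(T(x_n))$ is un-null for every disjoint sequence $(x_n)$ in $E$. 3. $T$ is order weakly compact. (B) The following are equivalent: 1. For every sequence $(x_n)$ in $E$, $(x_n)$ is uaw-null if and only if it is un-null. 2. Every disjoint sequence in $E$ is un-null. 3. $E$ is order continuous. -/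

import Mathlib

open Filter Topology

universe u v

/-- `(x n)` is uaw-null: `|x n| ⊓ u` converges weakly to `0` for every `u ≥ 0`. -/
def UawNull {E : Type u} [NormedAddCommGroup E] [NormedSpace ℝ E] [Lattice E]
    (x : ℕ → E) : Prop :=
  ∀ u : E, 0 ≤ u → Tendsto (fun n => toWeakSpace ℝ E (|x n| ⊓ u)) atTop (𝓝 0)

/-- `(x n)` is un-null: `‖|x n| ⊓ u‖` converges to `0` for every `u ≥ 0`. -/
def UnNull {E : Type u} [NormedAddCommGroup E] [Lattice E] (x : ℕ → E) : Prop :=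
  ∀ u : E, 0 ≤ u → Tendsto (fun n => ‖|x n| ⊓ u‖) atTop (𝓝 0)

/-- The terms of `(x n)` are pairwise disjoint elements of the lattice. -/
def DisjointSeq {E : Type u} [NormedAddCommGroup E] [Lattice E] (x : ℕ → E) : Prop :=
  ∀ m n : ℕ, m ≠ n → |x m| ⊓ |x n| = 0

/-- A linear map between vector lattices is a lattice homomorphism if it preserves finite suprema
(and hence, being linear, also finite infima, absolute values and positivity). -/
def IsLatticeHomomorphism {E : Type u} {F : Type v}
    [NormedAddCommGroup E] [NormedSpace ℝ E] [Lattice E]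
    [NormedAddCommGroup F] [NormedSpace ℝ F] [Lattice F] (T : E →ₗ[ℝ] F) : Prop :=
  ∀ x y : E, T (x ⊔ y) = T x ⊔ T y

/-- `T` is order weakly compact: it maps each order interval `[0, x]` to a relatively weakly compact
set. -/
def OrderWeaklyCompact {E : Type u} {F : Type v}
    [NormedAddCommGroup E] [NormedSpace ℝ E] [Lattice E]
    [NormedAddCommGroup F] [NormedSpace ℝ F] (T : E →ₗ[ℝ] F) : Prop :=
  ∀ x : E, 0 ≤ x → IsCompact (closure (toWeakSpace ℝ F '' (T '' Set.Icc 0 x)))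

/-- The norm of `E` is order continuous: every net that decreases to `0` converges to `0` in norm.
Index sets in the universe of `E` are enough, since the range of a decreasing net, directed
downwards, is itself a decreasing net with the same infimum. -/
def OrderContinuousNorm (E : Type u) [NormedAddCommGroup E] [Lattice E] : Prop :=
  ∀ (ι : Type u) [Preorder ι] [IsDirected ι (· ≤ ·)] [Nonempty ι] (x : ι → E),
    Antitone x → IsGLB (Set.range x) 0 → Tendsto (fun i => ‖x i‖) atTop (𝓝 0)

/-! Everything reduces to one property of an order interval, `DisjointNullBelow v`: disjoint
sequences in `[0, v]` are norm null. It holds exactly when `[0, v]` is relatively weakly compact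
(`DisjointNullBelow.isCompact_Icc`, `disjointNullBelow_of_isCompact`), it makes weakly null
sequences in `[0, v]` norm null (`DisjointNullBelow.tendsto_of_weakly_null`), and required for all
`v` it is order continuity of the norm. For (A) it is applied to `[0, T u]`, the image of `[0, u]`,
after disjoint sequences have been lifted through `T` up to a small error. Conversely, disjoint
sequences are uaw-null because order bounded disjoint sequences are weakly null.

The core is `DisjointNullBelow.exists_functional`: a single positive functional `f` controls the
norm on `[0, v]`. If none did, a sequence of norm above `ε`, each term nearly invisible to the
norming functionals of the earlier ones, could be made disjoint at small cost; the limits this needs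
come from norm convergence of decreasing nets in `[0, v]`. The statement on weakly null sequences is
then immediate. For weak compactness, `f` yields convex functions on `[0, v]` that are uniformly
convex up to any given error; their slices shrink to a point, the weak limit of a given ultrafilter.
-/

theorem inf_eq_zero_of_le {G : Type*} [Lattice G] [Zero G] {a b a' b' : G} (ha : 0 ≤ a)
    (hb : 0 ≤ b) (haa : a ≤ a') (hbb : b ≤ b')
    (h : a' ⊓ b' = 0) : a ⊓ b = 0 :=
  le_antisymm (h ▸ inf_le_inf haa hbb) (le_inf ha hb)

/-! ### Disjointness and positive parts in lattice-ordered groups. -/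

section LatticeGroup

variable {G : Type*} [AddCommGroup G] [Lattice G] [IsOrderedAddMonoid G]

theorem posPart_inf_posPart_neg (a : G) : (a ⊔ 0) ⊓ (-a ⊔ 0) = 0 :=
  posPart_inf_negPart_eq_zero a

theorem inf_add_eq_zero {x a b : G} (hx : 0 ≤ x) (ha : 0 ≤ a) (hb : 0 ≤ b) (hxa : x ⊓ a = 0)
    (hxb : x ⊓ b = 0) : x ⊓ (a + b) = 0 := by
  refine le_antisymm ?_ (le_inf hx (add_nonneg ha hb))
  have h1 : x ⊓ (a + b) - b ≤ x ⊓ a :=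
    le_inf ((sub_le_self _ hb).trans inf_le_left) (sub_le_iff_le_add.2 inf_le_right)
  rw [hxa, sub_nonpos] at h1
  exact (le_inf inf_le_left h1).trans hxb.le

theorem inf_sum_eq_zero {ι : Type*} {x : G} {a : ι → G} (s : Finset ι) (hx : 0 ≤ x)
    (ha : ∀ i, 0 ≤ a i) (h : ∀ i ∈ s, x ⊓ a i = 0) : x ⊓ ∑ i ∈ s, a i = 0 := by
  classical
  induction s using Finset.induction_on with
  | empty => simpa using hx
  | insert i s hi ih =>
    rw [Finset.sum_insert hi]
    exact inf_add_eq_zero hx (ha i) (Finset.sum_nonneg fun j _ => ha j)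
      (h i (Finset.mem_insert_self i s)) (ih fun j hj => h j (Finset.mem_insert_of_mem hj))

/-- A sum of disjoint elements is their supremum, by `a ⊓ b + a ⊔ b = a + b`. -/
theorem sum_le_of_pairwise_inf_eq_zero {ι : Type*} {u : G} {y : ι → G} (s : Finset ι) (hu : 0 ≤ u)
    (h0 : ∀ i, 0 ≤ y i) (hyu : ∀ i, y i ≤ u) (h : ∀ i j, i ≠ j → y i ⊓ y j = 0) :
    ∑ i ∈ s, y i ≤ u := by
  classical
  induction s using Finset.induction_on with
  | empty => simpa using hu
  | insert i s hi ih =>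
    rw [Finset.sum_insert hi]
    have hd : y i ⊓ ∑ j ∈ s, y j = 0 :=
      inf_sum_eq_zero s (h0 i) h0 fun j hj => h i j fun hij => hi (hij ▸ hj)
    have := inf_add_sup (y i) (∑ j ∈ s, y j)
    rw [hd, zero_add] at this
    exact this ▸ sup_le (hyu i) ih

theorem sub_inf_inf_sub_inf (a b : G) : (a - a ⊓ b) ⊓ (b - a ⊓ b) = 0 := by
  rw [← inf_sub, sub_self]

theorem le_posPart_sub_add {a b : G} : a ≤ (a - b) ⊔ 0 + b :=
  sub_le_iff_le_add.1 le_sup_left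

theorem sub_sup_zero_le {a b : G} (ha : 0 ≤ a) (hb : 0 ≤ b) : (a - b) ⊔ 0 ≤ a :=
  sup_le (sub_le_self a hb) ha

/-- A nonnegative lower bound of `(a i)⁺`, `i ∈ s`, vanishes if the `a i` have nonpositive sum. -/
theorem eq_zero_of_le_posPart_of_sum_nonpos {ι : Type*} {a : ι → G} {s : Finset ι}
    (hs : s.Nonempty) (hsum : ∑ i ∈ s, a i ≤ 0) {x : G} (hx : 0 ≤ x)
    (h : ∀ i ∈ s, x ≤ a i ⊔ 0) : x = 0 := by
  -- Below every positive part, `x` is disjoint from every negative part; the negative parts have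
  -- the larger sum, so `x` lies below that sum and is disjoint from itself.
  have h1 : x ⊓ ∑ i ∈ s, (-a i ⊔ 0) = 0 :=
    inf_sum_eq_zero s hx (fun _ => le_sup_right) fun i hi =>
      inf_eq_zero_of_le hx le_sup_right (h i hi) le_rfl (posPart_inf_posPart_neg (a i))
  have h2 : ∑ i ∈ s, (a i ⊔ 0) ≤ ∑ i ∈ s, (-a i ⊔ 0) := by
    have : ∑ i ∈ s, a i = ∑ i ∈ s, (a i ⊔ 0) - ∑ i ∈ s, (-a i ⊔ 0) := by
      rw [← Finset.sum_sub_distrib]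
      exact Finset.sum_congr rfl fun i _ => (posPart_sub_negPart (a i)).symm
    rwa [this, sub_nonpos] at hsum
  obtain ⟨i, hi⟩ := hs
  have h3 : x ≤ ∑ i ∈ s, (-a i ⊔ 0) :=
    ((h i hi).trans (Finset.single_le_sum (f := fun i => a i ⊔ 0) (fun _ _ => le_sup_right)
      hi)).trans h2
  rwa [inf_eq_left.2 h3] at h1

/-- A lower bound of the distances of `m ≥ 0` to the multiples `0, e, …, N e` is at most `e`
plus the excess of `m` over `N e`. -/
theorem le_of_forall_le_abs_sub_nsmul {e m r : G} (he : 0 ≤ e) (hm : 0 ≤ m) (N : ℕ)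
    (h : ∀ j ≤ N, r ≤ |m - j • e|) : r ≤ e + ((m - N • e) ⊔ 0) := by
  induction N with
  | zero =>
    have := h 0 le_rfl
    simp only [zero_smul, sub_zero, abs_of_nonneg hm] at this ⊢
    exact this.trans ((le_sup_left).trans (le_add_of_nonneg_left he))
  | succ N ih =>
    have h1 := ih fun j hj => h j (hj.trans N.le_succ)
    have h2 := h (N + 1) le_rfl
    have h3 : m - (N + 1) • e = m - N • e - e := by rw [succ_nsmul]; abel
    rw [h3] at h2 ⊢
    set t := m - N • e
    let := AddCommGroup.toDistribLattice G
    -- By distributivity there are two cases for `|t - e|`: `t - e` is part of the allowed excess,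
    -- and `e - t` meets `e + t⁺` below `e` because `t⁺ ⊓ -t ≤ 0`.
    have h4 : r ≤ (e + (t ⊔ 0)) ⊓ ((t - e) ⊔ -(t - e)) := le_inf h1 h2
    refine h4.trans ?_
    rw [inf_sup_left]
    refine sup_le ((inf_le_right.trans le_sup_left).trans (le_add_of_nonneg_left he)) ?_
    rw [neg_sub, sub_eq_add_neg, ← add_inf]
    have h5 : (t ⊔ 0) ⊓ -t ≤ 0 :=
      (inf_le_inf_left _ le_sup_left).trans (posPart_inf_posPart_neg t).le
    exact add_le_add_right (h5.trans le_sup_right) e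

/-- Where `p` is positive and `q` negative, cancellation in `p + q` lowers the positive part by `p ⊓
-q`. This bounds from below the convexity gap in `apply_posPart_sub_le`. -/
theorem posPart_inf_neg_add_posPart_add_le (p q : G) :
    (p ⊓ -q) ⊔ 0 + (p + q) ⊔ 0 ≤ p ⊔ 0 + q ⊔ 0 := by
  rw [add_comm, ← le_sub_iff_add_le]
  refine sup_le ?_ ?_
  · rw [le_sub_iff_add_le]
    have : (p ⊓ -q) ⊔ 0 ≤ q ⊔ 0 - q := by
      rw [sup_sub, sub_self, zero_sub, sup_comm]
      exact sup_le_sup_left inf_le_right _ |>.trans (by rw [sup_comm])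
    calc p + q + (p ⊓ -q) ⊔ 0 ≤ p + q + (q ⊔ 0 - q) := add_le_add_right this _
      _ = p + q ⊔ 0 := by abel
      _ ≤ _ := add_le_add_left le_sup_left _
  · rw [le_sub_iff_add_le, zero_add]
    exact (sup_le_sup_right inf_le_left 0).trans (le_add_of_nonneg_right le_sup_right)

end LatticeGroup

section VectorLattice

variable {G : Type*} [AddCommGroup G] [Lattice G] [IsOrderedAddMonoid G] [Module ℝ G]
  [IsOrderedModule ℝ G]

/-- The second factor is `c⁻¹` times the negative part of `u - c • z`. This is the disjointification
device: take a large multiple of `z` off one element and a small multiple of `u` off the other. -/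
theorem sub_smul_inf_sub_inv_smul_eq_zero {c : ℝ} (hc : 1 ≤ c) (u z : G) :
    ((u - c • z) ⊔ 0) ⊓ ((z - c⁻¹ • u) ⊔ 0) = 0 := by
  have hc0 : 0 < c := zero_lt_one.trans_le hc
  refine inf_eq_zero_of_le le_sup_right le_sup_right le_rfl ?_ (posPart_inf_posPart_neg (u - c • z))
  refine sup_le ?_ le_sup_right
  have : z - c⁻¹ • u = c⁻¹ • (c • z - u) := by rw [smul_sub, inv_smul_smul₀ hc0.ne']
  rw [this, neg_sub]
  calc c⁻¹ • (c • z - u) ≤ c⁻¹ • ((c • z - u) ⊔ 0) :=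
        smul_le_smul_of_nonneg_left le_sup_left (inv_nonneg.2 hc0.le)
    _ ≤ (1 : ℝ) • ((c • z - u) ⊔ 0) :=
        smul_le_smul_of_nonneg_right (inv_le_one_of_one_le₀ hc) le_sup_right
    _ = _ := one_smul _ _

end VectorLattice

/-- Every disjoint sequence in the order interval `[0, v]` is norm null. -/
def DisjointNullBelow {E : Type*} [NormedAddCommGroup E] [Lattice E] (v : E) : Prop :=
  ∀ y : ℕ → E, (∀ n, 0 ≤ y n) → (∀ n, y n ≤ v) → (∀ m n, m ≠ n → y m ⊓ y n = 0) →
    Tendsto (fun n => ‖y n‖) atTop (𝓝 0)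

/-- Diagonal choice: each new index exceeds the sum, hence every one, of the thresholds attached to
the indices up to the current one. -/
theorem exists_strictMono_forall_lt {R : ℕ → ℕ → ℝ} (hR : ∀ i, Tendsto (R i) atTop (𝓝 0))
    {c : ℕ → ℝ} (hc : ∀ n, 0 < c n) :
    ∃ ψ : ℕ → ℕ, StrictMono ψ ∧ ∀ i j, i < j → R (ψ i) (ψ j) < c j := by
  have h : ∀ i n, ∃ N, ∀ m ≥ N, R i m < c n := fun i n =>
    eventually_atTop.1 ((hR i).eventually_lt_const (hc n))
  choose N hN using h
  let ψ : ℕ → ℕ := fun n => Nat.rec 0 (fun n k => k + 1 + ∑ i ∈ Finset.range (k + 1), N i (n + 1)) n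
  have hs : ∀ n, ψ (n + 1) = ψ n + 1 + ∑ i ∈ Finset.range (ψ n + 1), N i (n + 1) := fun n => rfl
  have hψ : StrictMono ψ := strictMono_nat_of_lt_succ fun n => by rw [hs]; omega
  refine ⟨ψ, hψ, fun i j hij => ?_⟩
  obtain ⟨k, rfl⟩ : ∃ k, j = k + 1 := ⟨j - 1, by omega⟩
  refine hN _ _ _ ?_
  rw [hs]
  have hik : ψ i ≤ ψ k := hψ.monotone (by omega)
  have := Finset.single_le_sum (f := fun i => N i (k + 1)) (s := Finset.range (ψ k + 1))
    (fun _ _ => Nat.zero_le _) (Finset.mem_range.2 (Nat.lt_succ_of_le hik))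
  omega

/-! ### From disjoint sequences to sequences of bounded multiplicity. -/

section NormedLattice

variable {E : Type*} [NormedAddCommGroup E] [Lattice E] [IsOrderedAddMonoid E] [HasSolidNorm E]

theorem norm_le_norm_of_nonneg_of_le {a b : E} (ha : 0 ≤ a) (hab : a ≤ b) : ‖a‖ ≤ ‖b‖ :=
  norm_le_norm_of_abs_le_abs (by rwa [abs_of_nonneg ha, abs_of_nonneg (ha.trans hab)])

variable [CompleteSpace E]

/-- An almost disjoint sequence is close to a disjoint one below it. -/
theorem exists_disjoint_of_norm_inf_le {g : ℕ → E} (hg : ∀ n, 0 ≤ g n) {ε : ℝ}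
    (h : ∀ i j, i ≠ j → ‖g i ⊓ g j‖ ≤ ε * (1 / 2) ^ i * (1 / 2) ^ j) :
    ∃ w : ℕ → E, (∀ n, 0 ≤ w n) ∧ (∀ n, w n ≤ g n) ∧ (∀ m n, m ≠ n → w m ⊓ w n = 0) ∧
      ∀ n, ‖g n‖ ≤ ‖w n‖ + 2 * ε := by
  have hε : 0 ≤ ε := by
    have := (norm_nonneg _).trans (h 0 1 (by norm_num))
    norm_num at this
    linarith
  -- The overlaps of `g n` with the other terms. Subtracting all of them makes the sequence
  -- disjoint, and their total norm is at most `2 * ε`.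
  let q : ℕ → ℕ → E := fun n m => if m = n then 0 else g n ⊓ g m
  have hq0 : ∀ n m, 0 ≤ q n m := fun n m => by
    simp only [q]; split_ifs
    exacts [le_rfl, le_inf (hg n) (hg m)]
  have hqb : ∀ n m, ‖q n m‖ ≤ ε * (1 / 2) ^ m := fun n m => by
    simp only [q]; split_ifs with hnm
    · simpa using by positivity
    · refine (h n m (Ne.symm hnm)).trans ?_
      refine mul_le_mul_of_nonneg_right ?_ (by positivity)
      exact mul_le_of_le_one_right hε (pow_le_one₀ (by norm_num) (by norm_num))
  have hgeom : HasSum (fun m : ℕ => ε * (1 / 2 : ℝ) ^ m) (2 * ε) := by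
    rw [mul_comm 2]; exact hasSum_geometric_two.mul_left ε
  have hqs : ∀ n, Summable (q n) := fun n => Summable.of_norm_bounded hgeom.summable (hqb n)
  have hle : ∀ n m, q n m ≤ ∑' m, q n m := fun n m => (hqs n).le_tsum m fun j _ => hq0 n j
  have hQ0 : ∀ n, 0 ≤ ∑' m, q n m := fun n => tsum_nonneg (hq0 n)
  refine ⟨fun n => (g n - ∑' m, q n m) ⊔ 0, fun n => le_sup_right,
    fun n => sub_sup_zero_le (hg n) (hQ0 n), fun m n hmn => ?_, fun n => ?_⟩
  · refine inf_eq_zero_of_le le_sup_right le_sup_right ?_ ?_ (sub_inf_inf_sub_inf (g m) (g n))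
    · refine sup_le (sub_le_sub_left ?_ _) (sub_nonneg.2 inf_le_left)
      simpa [q, hmn.symm] using hle m n
    · refine sup_le (sub_le_sub_left ?_ _) (sub_nonneg.2 inf_le_right)
      simpa [q, hmn, inf_comm] using hle n m
  · calc ‖g n‖ ≤ ‖(g n - ∑' m, q n m) ⊔ 0 + ∑' m, q n m‖ :=
          norm_le_norm_of_nonneg_of_le (hg n) le_posPart_sub_add
      _ ≤ _ := (norm_add_le _ _).trans
          (add_le_add_right (tsum_of_norm_bounded hgeom (hqb n)) _)

/-- Induction on the multiplicity. The meets of the terms with one fixed term have multiplicity one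
less, hence are null; so a subsequence of terms of norm at least `ε` can be thinned until it is
almost disjoint, and a disjoint sequence below it keeps norm at least `ε / 2`. -/
theorem DisjointNullBelow.tendsto_of_multiplicity {v : E} (hv : DisjointNullBelow v) (M : ℕ) :
    ∀ g : ℕ → E, (∀ n, 0 ≤ g n) → (∀ n, g n ≤ v) →
      (∀ s : Finset ℕ, s.card = M + 1 → ∀ x, 0 ≤ x → (∀ n ∈ s, x ≤ g n) → x = 0) →
      Tendsto (fun n => ‖g n‖) atTop (𝓝 0) := by
  induction M with
  | zero =>
    intro g hg0 _ h
    have : ∀ n, g n = 0 := fun n => h {n} rfl (g n) (hg0 n) fun m hm => by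
      rw [Finset.mem_singleton.1 hm]
    simp [this]
  | succ M ih =>
    intro g hg0 hgv h
    by_contra hcon
    obtain ⟨ε, hε, hfr⟩ : ∃ ε > 0, ∃ᶠ n in atTop, ε ≤ ‖g n‖ := by
      by_contra! hne
      refine hcon (Metric.tendsto_atTop'.2 fun ε hε => ?_)
      obtain ⟨N, hN⟩ := eventually_atTop.1 (hne ε hε)
      exact ⟨N, fun n hn => by simpa using hN n hn.le⟩
    obtain ⟨φ, hφ, hφε⟩ := extraction_of_frequently_atTop hfr
    have hfix : ∀ n, Tendsto (fun m => ‖g (φ n) ⊓ g (φ m)‖) atTop (𝓝 0) := fun n => by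
      -- The shift keeps `φ n` distinct from the other indices, so that it really adds one element
      -- to the finite set.
      refine (tendsto_add_atTop_iff_nat (n + 1)).1
        (ih (fun k => g (φ n) ⊓ g (φ (k + (n + 1)))) (fun k => le_inf (hg0 _) (hg0 _))
          (fun k => inf_le_left.trans (hgv _)) fun s hs x hx hxs => ?_)
      have hinj : Function.Injective fun k => φ (k + (n + 1)) :=
        hφ.injective.comp (add_left_injective _)
      refine h (insert (φ n) (s.image fun k => φ (k + (n + 1)))) ?_ x hx fun m hm => ?_
      · rw [Finset.card_insert_of_notMem, Finset.card_image_of_injective _ hinj, hs]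
        simp only [Finset.mem_image, not_exists, not_and]
        intro k _ hk
        have := hφ.injective hk
        omega
      · rcases Finset.mem_insert.1 hm with rfl | hm
        · obtain ⟨k, hk⟩ : s.Nonempty := Finset.card_pos.1 (by omega)
          exact (hxs k hk).trans inf_le_left
        · obtain ⟨k, hk, rfl⟩ := Finset.mem_image.1 hm
          exact (hxs k hk).trans inf_le_right
    -- For `i < j`, `(1 / 4) ^ j ≤ (1 / 2) ^ i * (1 / 2) ^ j`, the symmetric form needed below.
    obtain ⟨ψ, -, hψ⟩ := exists_strictMono_forall_lt hfix
      (c := fun j => ε / 4 * (1 / 4 : ℝ) ^ j) fun j => by positivity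
    have hlt : ∀ i j, i < j → ‖g (φ (ψ i)) ⊓ g (φ (ψ j))‖ ≤ ε / 4 * (1 / 2) ^ i * (1 / 2) ^ j := by
      intro i j hij
      refine (hψ i j hij).le.trans ?_
      have h4 : (1 / 4 : ℝ) ^ j = (1 / 2) ^ j * (1 / 2) ^ j := by rw [← mul_pow]; norm_num
      rw [h4, mul_assoc (ε / 4)]
      refine mul_le_mul_of_nonneg_left (mul_le_mul_of_nonneg_right ?_ (by positivity))
        (by positivity)
      exact pow_le_pow_of_le_one (by norm_num) (by norm_num) hij.le
    obtain ⟨w, hw0, hwg, hwd, hwn⟩ := exists_disjoint_of_norm_inf_le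
      (g := fun n => g (φ (ψ n))) (fun n => hg0 _) (ε := ε / 4) fun i j hij => by
        rcases hij.lt_or_gt with hij | hij
        · exact hlt i j hij
        · rw [inf_comm, mul_right_comm]
          exact hlt j i hij
    have hlim := hv w hw0 (fun n => (hwg n).trans (hgv _)) hwd
    have hge : ε / 2 ≤ 0 := ge_of_tendsto' hlim fun n => by
      have h1 := hwn n
      have h2 := hφε (ψ n)
      linarith
    linarith

end NormedLattice

/-! ### Norm convergence of order bounded monotone nets. -/

section NormedVectorLattice

variable {E : Type*} [NormedAddCommGroup E] [NormedSpace ℝ E] [Lattice E] [IsOrderedAddMonoid E]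
  [IsOrderedModule ℝ E] [HasSolidNorm E] [CompleteSpace E]

/-- With `δ = 1 / (K + 1)`, any `K + 1` of the elements `d n - δ • v` have sum at most `v - v = 0`,
so their positive parts have multiplicity at most `K` and are null. What was cut off has norm `δ *
‖v‖ < ε / 2`. -/
theorem DisjointNullBelow.tendsto_of_sum_le {v : E} (hv : DisjointNullBelow v) {d : ℕ → E}
    (hd : ∀ n, 0 ≤ d n) (hsum : ∀ s : Finset ℕ, ∑ n ∈ s, d n ≤ v) :
    Tendsto (fun n => ‖d n‖) atTop (𝓝 0) := by
  have hv0 : 0 ≤ v := by simpa using hsum ∅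
  have hdv : ∀ n, d n ≤ v := fun n => by simpa using hsum {n}
  refine Metric.tendsto_atTop.2 fun ε hε => ?_
  obtain ⟨K, hK⟩ := exists_nat_gt (2 * ‖v‖ / ε)
  let δ : ℝ := 1 / (K + 1)
  have hK0 : (0 : ℝ) < K + 1 := by positivity
  have hδ0 : 0 ≤ δ := by positivity
  have hδ : δ * ‖v‖ < ε / 2 := by
    rw [div_lt_iff₀ hε] at hK
    simp only [δ]
    rw [div_mul_eq_mul_div, one_mul, div_lt_iff₀ hK0]
    linarith
  have hδv : 0 ≤ δ • v := smul_nonneg hδ0 hv0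
  have hg := hv.tendsto_of_multiplicity K (fun n => (d n - δ • v) ⊔ 0) (fun n => le_sup_right)
    (fun n => (sub_sup_zero_le (hd n) hδv).trans (hdv n)) fun s hs x hx hxs => by
      refine eq_zero_of_le_posPart_of_sum_nonpos (Finset.card_pos.1 (by omega)) ?_ hx hxs
      rw [Finset.sum_sub_distrib, Finset.sum_const, hs, sub_nonpos, ← Nat.cast_smul_eq_nsmul ℝ,
        smul_smul]
      have : ((K + 1 : ℕ) : ℝ) * δ = 1 := by
        simp only [δ]; push_cast; field_simp
      rw [this, one_smul]
      exact hsum s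
  obtain ⟨N, hN⟩ := Metric.tendsto_atTop.1 hg (ε / 2) (by positivity)
  refine ⟨N, fun n hn => ?_⟩
  have h1 := hN n hn
  simp only [dist_zero_right, norm_norm] at h1 ⊢
  have h2 : ‖d n‖ ≤ ‖(d n - δ • v) ⊔ 0 + δ • v‖ :=
    norm_le_norm_of_nonneg_of_le (hd n) le_posPart_sub_add
  have h3 := norm_add_le ((d n - δ • v) ⊔ 0) (δ • v)
  rw [norm_smul, Real.norm_of_nonneg hδ0] at h3
  linarith

/-- Decreasing nets in `[0, v]` converge in norm. -/
theorem DisjointNullBelow.exists_tendsto_of_antitone {v : E} (hv : DisjointNullBelow v)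
    {ι : Type*} [Preorder ι] [IsDirected ι (· ≤ ·)] [Nonempty ι] {x : ι → E} (hx : Antitone x)
    (hx0 : ∀ i, 0 ≤ x i) (hxv : ∀ i, x i ≤ v) : ∃ a, Tendsto x atTop (𝓝 a) := by
  have key : ∀ ε > 0, ∃ i, ∀ j ≥ i, ‖x i - x j‖ ≤ ε := by
    by_contra! hcon
    obtain ⟨ε, hε, h⟩ := hcon
    choose J hJ hJε using h
    -- If the net is not Cauchy, it has successive decrements of norm above `ε`; they telescope to
    -- at most `v`, against `tendsto_of_sum_le`.
    let i : ℕ → ι := fun n => Nat.rec (Classical.arbitrary ι) (fun _ k => J k) n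
    have hi : ∀ n, i (n + 1) = J (i n) := fun n => rfl
    have hd : ∀ n, 0 ≤ x (i n) - x (i (n + 1)) := fun n => sub_nonneg.2 (hx (hi n ▸ hJ (i n)))
    have hlim := hv.tendsto_of_sum_le hd fun s => by
      obtain ⟨N, hN⟩ := s.exists_nat_subset_range
      calc ∑ n ∈ s, (x (i n) - x (i (n + 1)))
          ≤ ∑ n ∈ Finset.range N, (x (i n) - x (i (n + 1))) :=
            Finset.sum_le_sum_of_subset_of_nonneg hN fun n _ _ => hd n
        _ = x (i 0) - x (i N) := Finset.sum_range_sub' (fun n => x (i n)) N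
        _ ≤ v := (sub_le_self _ (hx0 _)).trans (hxv _)
    exact absurd (ge_of_tendsto' hlim fun n => (hJε (i n)).le) (not_le.2 hε)
  have hc : Cauchy (map x atTop) := by
    refine Metric.cauchy_iff.2 ⟨inferInstance, fun ε hε => ?_⟩
    obtain ⟨i, hi⟩ := key (ε / 3) (by positivity)
    refine ⟨x '' Set.Ici i, image_mem_map (mem_atTop i), ?_⟩
    rintro _ ⟨j, hj, rfl⟩ _ ⟨k, hk, rfl⟩
    have h1 := hi j hj
    have h2 := hi k hk
    rw [← dist_eq_norm] at h1 h2
    have := dist_triangle_left (x j) (x k) (x i)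
    linarith
  exact CompleteSpace.complete hc

end NormedVectorLattice

/-! ### Weak convergence tested on functionals. -/

section WeakTopology

variable {E : Type*} [NormedAddCommGroup E] [NormedSpace ℝ E]

theorem tendsto_toWeakSpace_iff {ι : Type*} {l : Filter ι} {z : ι → E} {a : E} :
    Tendsto (fun i => toWeakSpace ℝ E (z i)) l (𝓝 (toWeakSpace ℝ E a)) ↔
      ∀ f : E →L[ℝ] ℝ, Tendsto (fun i => f (z i)) l (𝓝 (f a)) := by
  refine WeakBilin.tendsto_iff_forall_eval_tendsto (topDualPairing ℝ E).flip ?_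
  intro x y hxy
  by_contra hne
  obtain ⟨f, hf⟩ := SeparatingDual.exists_separating_of_ne (R := ℝ) (show (x : E) ≠ y from hne)
  exact hf (LinearMap.congr_fun hxy f)

theorem tendsto_toWeakSpace_zero_iff {ι : Type*} {l : Filter ι} {z : ι → E} :
    Tendsto (fun i => toWeakSpace ℝ E (z i)) l (𝓝 0) ↔
      ∀ f : E →L[ℝ] ℝ, Tendsto (fun i => f (z i)) l (𝓝 0) := by
  simpa using tendsto_toWeakSpace_iff (l := l) (z := z) (a := 0)

end WeakTopology

theorem smul_posPart_eq {E : Type*} [AddCommGroup E] [Module ℝ E] [Lattice E]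
    [IsOrderedModule ℝ E] {c : ℝ} (hc : 0 < c) (x : E) : (c • x) ⊔ 0 = c • (x ⊔ 0) := by
  refine le_antisymm (sup_le (smul_le_smul_of_nonneg_left le_sup_left hc.le)
    (smul_nonneg hc.le le_sup_right)) ?_
  rw [← le_inv_smul_iff_of_pos hc]
  exact sup_le (le_inv_smul_iff_of_pos hc |>.2 le_sup_left)
    (smul_nonneg (inv_nonneg.2 hc.le) le_sup_right)

theorem monotone_of_nonneg {E : Type*} [NormedAddCommGroup E] [NormedSpace ℝ E] [Lattice E]
    [IsOrderedAddMonoid E] {f : E →L[ℝ] ℝ} (hf : ∀ x, 0 ≤ x → 0 ≤ f x) {x y : E} (h : x ≤ y) :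
    f x ≤ f y := by
  have := hf _ (sub_nonneg.2 h)
  rw [map_sub] at this
  linarith

/-! ### Positive functionals and their control of the norm on an order interval. -/

section Lattice

variable {E : Type*} [NormedAddCommGroup E] [NormedSpace ℝ E] [Lattice E] [IsOrderedAddMonoid E]
  [IsOrderedModule ℝ E] [HasSolidNorm E]

/-- A disjoint sequence in `[0, v]` is weakly null. -/
theorem tendsto_apply_of_disjoint {v : E} {y : ℕ → E} (hy0 : ∀ n, 0 ≤ y n) (hyv : ∀ n, y n ≤ v)
    (hd : ∀ m n, m ≠ n → y m ⊓ y n = 0) (f : E →L[ℝ] ℝ) :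
    Tendsto (fun n => f (y n)) atTop (𝓝 0) := by
  have hv : 0 ≤ v := (hy0 0).trans (hyv 0)
  refine tendsto_zero_iff_norm_tendsto_zero.2 (Summable.tendsto_atTop_zero ?_)
  refine summable_of_sum_le (c := ‖f‖ * ‖v‖) (fun _ => norm_nonneg _) fun s => ?_
  -- With these signs `∑ |f (y n)|` is the value of `f` at an element of modulus at most `v`, so the
  -- series converges absolutely.
  let σ : ℕ → ℝ := fun n => SignType.sign (f (y n))
  have hσ : ∀ n, |σ n| ≤ 1 := fun n => by
    simp only [σ]
    rcases lt_trichotomy (f (y n)) 0 with h | h | h <;> simp [h]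
  have h1 : ∑ n ∈ s, ‖f (y n)‖ = f (∑ n ∈ s, σ n • y n) := by
    rw [map_sum]
    refine Finset.sum_congr rfl fun n _ => ?_
    rw [map_smul, smul_eq_mul, Real.norm_eq_abs, sign_mul_self]
  have habs : ∀ n, |σ n • y n| ≤ y n := fun n => by
    have h1 := abs_le.1 (hσ n)
    refine abs_le'.2 ⟨?_, ?_⟩
    · exact (smul_le_smul_of_nonneg_right h1.2 (hy0 n)).trans (one_smul ℝ _).le
    · rw [← neg_smul]
      exact (smul_le_smul_of_nonneg_right (by linarith) (hy0 n)).trans (one_smul ℝ _).le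
  have h2 : ‖∑ n ∈ s, σ n • y n‖ ≤ ‖v‖ := by
    refine norm_le_norm_of_abs_le_abs ?_
    rw [abs_of_nonneg hv]
    refine le_trans ?_ (sum_le_of_pairwise_inf_eq_zero s hv hy0 hyv hd)
    refine abs_le'.2 ⟨Finset.sum_le_sum fun n _ => (le_abs_self _).trans (habs n), ?_⟩
    rw [← Finset.sum_neg_distrib]
    exact Finset.sum_le_sum fun n _ => (neg_le_abs _).trans (habs n)
  rw [h1]
  exact (le_abs_self _).trans ((f.le_opNorm _).trans
    (mul_le_mul_of_nonneg_left h2 (norm_nonneg _)))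

/-- Every element `z ≥ 0` of a normed lattice is normed by a positive functional. -/
theorem exists_nonneg_functional {z : E} (hz : 0 ≤ z) :
    ∃ f : E →L[ℝ] ℝ, (∀ x, 0 ≤ x → 0 ≤ f x) ∧ (∀ x, f x ≤ ‖x‖) ∧ f z = ‖z‖ := by
  -- Hahn–Banach with the sublinear bound `‖x ⊔ 0‖`: it vanishes on negative elements, which forces
  -- the extension to be positive.
  obtain ⟨g, hg, hgN⟩ := exists_extension_of_le_sublinear
    (LinearPMap.mkSpanSingleton' (σ := RingHom.id ℝ) z ‖z‖ fun c hc => by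
      have : ‖c • z‖ = 0 := by rw [hc, norm_zero]
      rw [norm_smul, mul_eq_zero] at this
      rcases this with h | h
      · simp [norm_eq_zero.1 h]
      · simp [h])
    (fun x => ‖x ⊔ 0‖)
    (fun c hc x => by rw [smul_posPart_eq hc, norm_smul, Real.norm_of_nonneg hc.le])
    (fun x y => (norm_le_norm_of_nonneg_of_le le_sup_right
      (sup_le (add_le_add le_sup_left le_sup_left)
        (add_nonneg le_sup_right le_sup_right))).trans (norm_add_le _ _))
    (by
      rintro ⟨x, hx⟩
      obtain ⟨c, rfl⟩ := Submodule.mem_span_singleton.1 hx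
      rw [LinearPMap.mkSpanSingleton'_apply]
      simp only [RingHom.id_apply, smul_eq_mul]
      rcases le_or_gt c 0 with hc | hc
      · exact (mul_nonpos_of_nonpos_of_nonneg hc (norm_nonneg _)).trans (norm_nonneg _)
      · rw [smul_posPart_eq hc, norm_smul, Real.norm_of_nonneg hc.le, sup_eq_left.2 hz])
  have hle : ∀ x, g x ≤ ‖x‖ := fun x =>
    (hgN x).trans (by simpa using norm_sup_sub_sup_le_norm x 0 0)
  refine ⟨g.mkContinuous 1 fun x => ?_, fun x hx => ?_, hle, ?_⟩
  · rw [one_mul]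
    refine abs_le.2 ⟨?_, hle x⟩
    have := hle (-x)
    rw [map_neg, norm_neg] at this
    linarith
  · have := hgN (-x)
    rw [map_neg, sup_eq_right.2 (neg_nonpos.2 hx), norm_zero] at this
    exact neg_nonpos.1 this
  · exact (hg ⟨z, Submodule.mem_span_singleton_self z⟩).trans
      (LinearPMap.mkSpanSingleton'_apply_self _ _ _ _)

variable [CompleteSpace E]

/-- A disjointification: a sequence in `[0, v]` which is small for preceding norming functionals
is norm null. -/
theorem DisjointNullBelow.tendsto_of_triangular {v : E} (hv : DisjointNullBelow v) {z : ℕ → E}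
    (hz0 : ∀ n, 0 ≤ z n) (hzv : ∀ n, z n ≤ v) {φ : ℕ → E →L[ℝ] ℝ}
    (hφ0 : ∀ n x, 0 ≤ x → 0 ≤ φ n x) (hφ1 : ∀ n x, φ n x ≤ ‖x‖) (hφz : ∀ n, φ n (z n) = ‖z n‖)
    (hsmall : ∀ i n, i < n → φ i (z n) ≤ (1 / 8) ^ n) :
    Tendsto (fun n => ‖z n‖) atTop (𝓝 0) := by
  have hv0 : 0 ≤ v := (hz0 0).trans (hzv 0)
  -- From `z n` are removed the multiples `2 ^ m • z m` of later terms and `(2 ^ n)⁻¹ • v`. For `m <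
  -- n` this puts `w m N` below `(v - 2 ^ n • z n)⁺` and `w n N` below `(z n - (2 ^ n)⁻¹ • v)⁺`,
  -- which are disjoint. Since `∑ 2 ^ m • z m` need not converge, the limit in `N` is taken on the
  -- decreasing `w n N`.
  let S : ℕ → ℕ → E := fun n N => ∑ k ∈ Finset.range N, (2 : ℝ) ^ (n + 1 + k) • z (n + 1 + k)
  have hterm : ∀ m, 0 ≤ (2 : ℝ) ^ m • z m := fun m => smul_nonneg (by positivity) (hz0 m)
  have hS0 : ∀ n N, 0 ≤ S n N := fun n N => Finset.sum_nonneg fun k _ => hterm _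
  have hSle : ∀ n m N, n < m → m ≤ N → (2 : ℝ) ^ m • z m ≤ S n N := fun n m N hnm hmN => by
    obtain ⟨k, rfl⟩ : ∃ k, m = n + 1 + k := ⟨m - (n + 1), by omega⟩
    exact Finset.single_le_sum (f := fun k => (2 : ℝ) ^ (n + 1 + k) • z (n + 1 + k))
      (fun k _ => hterm _) (Finset.mem_range.2 (by omega))
  have hp : ∀ n, 0 ≤ ((2 : ℝ) ^ n)⁻¹ • v := fun n => smul_nonneg (by positivity) hv0
  let w : ℕ → ℕ → E := fun n N => (z n - (S n N + ((2 : ℝ) ^ n)⁻¹ • v)) ⊔ 0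
  have hw0 : ∀ n N, 0 ≤ w n N := fun n N => le_sup_right
  have hwv : ∀ n N, w n N ≤ v := fun n N =>
    (sub_sup_zero_le (hz0 n) (add_nonneg (hS0 n N) (hp n))).trans (hzv n)
  have hanti : ∀ n, Antitone (w n) := fun n N M hNM => by
    refine sup_le_sup_right (sub_le_sub_left (add_le_add_left ?_ _) _) 0
    exact Finset.sum_le_sum_of_subset_of_nonneg (Finset.range_mono hNM) fun k _ _ => hterm _
  have hlim := fun n => hv.exists_tendsto_of_antitone (hanti n) (hw0 n) (hwv n)
  choose a ha using hlim
  have ha0 : ∀ n, 0 ≤ a n := fun n => ge_of_tendsto' (ha n) (hw0 n)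
  have hlt : ∀ m n, m < n → a m ⊓ a n = 0 := fun m n hmn => by
    refine tendsto_nhds_unique ((ha m).inf_nhds (ha n)) ?_
    refine tendsto_const_nhds.congr' ?_
    filter_upwards [eventually_ge_atTop n] with N hN
    refine (inf_eq_zero_of_le (hw0 m N) (hw0 n N) ?_ ?_
      (sub_smul_inf_sub_inv_smul_eq_zero (c := 2 ^ n) (one_le_pow₀ (by norm_num)) v (z n))).symm
    · exact sup_le_sup_right (sub_le_sub (hzv m)
        ((hSle m n N hmn hN).trans (le_add_of_nonneg_right (hp m)))) 0
    · exact sup_le_sup_right (sub_le_sub_left (le_add_of_nonneg_left (hS0 n N)) _) 0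
  have hnull := hv a ha0 (fun n => le_of_tendsto' (ha n) (hwv n)) fun m n hmn => by
    rcases hmn.lt_or_gt with h | h
    · exact hlt m n h
    · rw [inf_comm]; exact hlt n m h
  -- The removed part may be large in norm, but it is small for `φ n`, which norms `z n`: the factor
  -- `8 ^ (-m)` beats the weight `2 ^ m`.
  have hSφ : ∀ n N, φ n (S n N) ≤ (1 / 2) ^ n := fun n N => by
    have hg := hasSum_geometric_two' ((1 / 2 : ℝ) ^ n)
    refine le_trans ?_ (sum_le_hasSum (Finset.range N) (fun k _ => by positivity) hg)
    simp only [S, map_sum, map_smul, smul_eq_mul]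
    refine Finset.sum_le_sum fun k _ => ?_
    calc (2 : ℝ) ^ (n + 1 + k) * φ n (z (n + 1 + k))
        ≤ 2 ^ (n + 1 + k) * (1 / 8) ^ (n + 1 + k) :=
          mul_le_mul_of_nonneg_left (hsmall _ _ (by omega)) (by positivity)
      _ = (1 / 4) ^ (n + 1 + k) := by rw [← mul_pow]; norm_num
      _ ≤ (1 / 2) ^ (n + 1 + k) := pow_le_pow_left₀ (by norm_num) (by norm_num) _
      _ = _ := by rw [pow_add, pow_add]; simp [div_eq_mul_inv]
  have hwn : ∀ n N, ‖z n‖ ≤ ‖w n N‖ + (1 / 2) ^ n * (1 + ‖v‖) := fun n N => by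
    have h1 : z n ≤ w n N + (S n N + ((2 : ℝ) ^ n)⁻¹ • v) := le_posPart_sub_add
    have h2 := monotone_of_nonneg (hφ0 n) h1
    rw [map_add, map_add, map_smul, smul_eq_mul, hφz] at h2
    have h3 : ((2 : ℝ) ^ n)⁻¹ * φ n v ≤ (1 / 2) ^ n * ‖v‖ := by
      rw [one_div, inv_pow]
      exact mul_le_mul_of_nonneg_left (hφ1 n v) (by positivity)
    have h4 := hφ1 n (w n N)
    have h5 := hSφ n N
    linarith
  have han : ∀ n, ‖z n‖ ≤ ‖a n‖ + (1 / 2) ^ n * (1 + ‖v‖) := fun n =>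
    ge_of_tendsto' ((ha n).norm.add_const _) (hwn n)
  have hpow : Tendsto (fun n : ℕ => (1 / 2 : ℝ) ^ n) atTop (𝓝 0) :=
    tendsto_pow_atTop_nhds_zero_of_lt_one (by norm_num) (by norm_num)
  refine squeeze_zero (fun n => norm_nonneg _) han ?_
  simpa using hnull.add (hpow.mul_const (1 + ‖v‖))

/-- On `[0, v]` the norm is absolutely continuous with respect to a positive functional. -/
theorem DisjointNullBelow.exists_functional {v : E} (hv : DisjointNullBelow v) {ε : ℝ}
    (hε : 0 < ε) : ∃ f : E →L[ℝ] ℝ, (∀ x, 0 ≤ x → 0 ≤ f x) ∧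
      ∃ δ > 0, ∀ z, 0 ≤ z → z ≤ v → f z ≤ δ → ‖z‖ ≤ ε := by
  by_contra! hcon
  let P := {f : E →L[ℝ] ℝ // ∀ x, 0 ≤ x → 0 ≤ f x}
  have h : ∀ (g : P) (n : ℕ), ∃ z, 0 ≤ z ∧ z ≤ v ∧ g.1 z ≤ (1 / 8) ^ n ∧ ε < ‖z‖ := fun g n =>
    hcon g.1 g.2 _ (by positivity)
  choose Z hZ0 hZv hZg hZε using h
  have h' : ∀ z : {z : E // 0 ≤ z}, ∃ f : P, (∀ x, f.1 x ≤ ‖x‖) ∧ f.1 z = ‖z.1‖ := fun z => by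
    obtain ⟨f, h0, h1, h2⟩ := exists_nonneg_functional z.2
    exact ⟨⟨f, h0⟩, h1, h2⟩
  choose Φ hΦ1 hΦz using h'
  let next : P → ℕ → P := fun g n => ⟨g.1 + (Φ ⟨Z g n, hZ0 g n⟩).1, fun x hx =>
    add_nonneg (g.2 x hx) ((Φ _).2 x hx)⟩
  -- `G n` is the sum of the norming functionals of the terms chosen before `n`. All are positive,
  -- so a small value of `G n` at the next term bounds each of them there.
  let G : ℕ → P := fun n => Nat.rec ⟨0, fun x _ => le_rfl⟩ (fun n g => next g n) n
  have hG : ∀ n x, (G (n + 1)).1 x = (G n).1 x + (Φ ⟨Z (G n) n, hZ0 (G n) n⟩).1 x :=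
    fun n x => rfl
  have hmono : ∀ x, 0 ≤ x → Monotone fun n => (G n).1 x := fun x hx =>
    monotone_nat_of_le_succ fun n => by
      rw [hG]
      exact le_add_of_nonneg_right ((Φ _).2 x hx)
  have hlim := hv.tendsto_of_triangular (z := fun n => Z (G n) n) (fun n => hZ0 _ _)
    (fun n => hZv _ _) (φ := fun n => (Φ ⟨Z (G n) n, hZ0 (G n) n⟩).1) (fun n => (Φ _).2)
    (fun n => hΦ1 _) (fun n => hΦz _) fun i n hin => by
      refine le_trans ?_ (hZg (G n) n)
      refine le_trans ?_ (hmono _ (hZ0 _ _) (Nat.succ_le_of_lt hin))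
      simp only [Nat.succ_eq_add_one, hG]
      exact le_add_of_nonneg_left ((G i).2 _ (hZ0 _ _))
  exact absurd (ge_of_tendsto' hlim fun n => (hZε (G n) n).le) (not_le.2 hε)

/-- A weakly null sequence in `[0, v]` is norm null. -/
theorem DisjointNullBelow.tendsto_of_weakly_null {v : E} (hv : DisjointNullBelow v) {z : ℕ → E}
    (hz0 : ∀ n, 0 ≤ z n) (hzv : ∀ n, z n ≤ v)
    (hz : ∀ f : E →L[ℝ] ℝ, Tendsto (fun n => f (z n)) atTop (𝓝 0)) :
    Tendsto (fun n => ‖z n‖) atTop (𝓝 0) := by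
  refine Metric.tendsto_atTop'.2 fun ε hε => ?_
  obtain ⟨f, -, δ, hδ, h⟩ := hv.exists_functional (half_pos hε)
  obtain ⟨N, hN⟩ := eventually_atTop.1 ((hz f).eventually_lt_const hδ)
  refine ⟨N, fun n hn => ?_⟩
  have := h (z n) (hz0 n) (hzv n) (hN n hn.le).le
  simp only [dist_zero_right, norm_norm]
  linarith

end Lattice

/-! ### Weak compactness of order intervals through approximate uniform convexity. -/

section WeakCompactness

variable {E : Type*} [NormedAddCommGroup E] [NormedSpace ℝ E]

/-- If a closed convex set carries functions that are uniformly convex up to `ε`, for every `ε`,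
then filters on it have a common point of the closed convex hulls of their members. -/
theorem exists_mem_closedConvexHull_of_uniformConvex [CompleteSpace E] {K : Set E}
    (hKc : IsClosed K) (hK : Convex ℝ K)
    (hΨ : ∀ ε > 0, ∃ Ψ : E → ℝ, Continuous Ψ ∧ ConvexOn ℝ Set.univ Ψ ∧ (∀ z, 0 ≤ Ψ z) ∧
      (∃ B, ∀ z ∈ K, Ψ z ≤ B) ∧ ∃ δ > 0, ∀ x ∈ K, ∀ y ∈ K,
        Ψ x + Ψ y - 2 * Ψ ((1 / 2 : ℝ) • (x + y)) ≤ δ → ‖x - y‖ ≤ ε)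
    (l : Filter E) [NeBot l] (hl : K ∈ l) :
    ∃ x ∈ K, ∀ A ∈ l, x ∈ closedConvexHull ℝ A := by
  let P := {C : Set E // IsClosed C ∧ Convex ℝ C ∧ C ⊆ K ∧
    ∀ A ∈ l, (C ∩ closedConvexHull ℝ A).Nonempty}
  have step : ∀ (ε : Set.Ioi (0 : ℝ)) (C : P), ∃ C' : P, C'.1 ⊆ C.1 ∧
      ∀ x ∈ C'.1, ∀ y ∈ C'.1, ‖x - y‖ ≤ ε := by
    rintro ⟨ε, hε⟩ ⟨C, hCc, hC, hCK, hCA⟩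
    obtain ⟨Ψ, hΨc, hΨx, hΨ0, ⟨B, hB⟩, δ, hδ, hgap⟩ := hΨ ε hε
    -- `sSup I` is the limiting infimum of `Ψ` along the hulls. The slice `Ψ ≤ sSup I + δ / 4` meets
    -- every hull, or the supremum would be larger. On `C ∩ closedConvexHull ℝ A` one has `Ψ > sSup
    -- I - δ / 4`, also at midpoints, so the gap on the slice is at most `δ`.
    let I : Set ℝ := {c | ∃ A ∈ l, ∀ z ∈ C ∩ closedConvexHull ℝ A, c ≤ Ψ z}
    have hI0 : (0 : ℝ) ∈ I := ⟨Set.univ, univ_mem, fun z _ => hΨ0 z⟩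
    have hIB : BddAbove I := by
      refine ⟨B, ?_⟩
      rintro c ⟨A, hA, h⟩
      obtain ⟨z, hz⟩ := hCA A hA
      exact (h z hz).trans (hB z (hCK hz.1))
    have hδ4 : 0 < δ / 4 := by positivity
    obtain ⟨c, ⟨A, hA, hAc⟩, hc⟩ := exists_lt_of_lt_csSup ⟨0, hI0⟩ (sub_lt_self (sSup I) hδ4)
    have hcl : ∀ A : Set E, IsClosed (closedConvexHull ℝ A) := fun A => isClosed_closedConvexHull
    have hcv : ∀ A : Set E, Convex ℝ (closedConvexHull ℝ A) := fun A => convex_closedConvexHull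
    refine ⟨⟨C ∩ closedConvexHull ℝ A ∩ {z | Ψ z ≤ sSup I + δ / 4},
      (hCc.inter (hcl A)).inter (isClosed_le hΨc continuous_const),
      (hC.inter (hcv A)).inter (by simpa using hΨx.convex_le (sSup I + δ / 4)),
      fun z hz => hCK hz.1.1, fun A' hA' => ?_⟩, fun z hz => hz.1.1, ?_⟩
    · by_contra hne
      have hmem : sSup I + δ / 4 ∈ I := by
        refine ⟨A ∩ A', inter_mem hA hA', fun z hz => ?_⟩
        by_contra! hlt
        exact hne ⟨z, ⟨⟨hz.1, (closedConvexHull ℝ).monotone Set.inter_subset_left hz.2⟩, hlt.le⟩,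
          (closedConvexHull ℝ).monotone Set.inter_subset_right hz.2⟩
      have := le_csSup hIB hmem
      linarith
    · intro x hx y hy
      refine hgap x (hCK hx.1.1) y (hCK hy.1.1) ?_
      have hm : (1 / 2 : ℝ) • (x + y) ∈ C ∩ closedConvexHull ℝ A := by
        rw [smul_add]
        exact (hC.inter (hcv A)) hx.1 hy.1 (by norm_num) (by norm_num) (by norm_num)
      have h1 := hAc _ hm
      have h2 : Ψ x ≤ _ := hx.2
      have h3 : Ψ y ≤ _ := hy.2
      linarith
  choose next hnext hdiam using step
  have hpos : ∀ n : ℕ, (1 / 2 : ℝ) ^ n ∈ Set.Ioi (0 : ℝ) := fun n => by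
    simp only [Set.mem_Ioi]; positivity
  let C0 : P := ⟨K, hKc, hK, subset_rfl, fun A hA => by
    obtain ⟨z, hz⟩ := NeBot.nonempty_of_mem ‹_› (inter_mem hl hA)
    exact ⟨z, hz.1, subset_closedConvexHull hz.2⟩⟩
  let C : ℕ → P := fun n => Nat.rec C0 (fun n D => next ⟨_, hpos n⟩ D) n
  have hC : ∀ n, C (n + 1) = next ⟨_, hpos n⟩ (C n) := fun n => rfl
  have hanti : Antitone fun n => (C n).1 := antitone_nat_of_succ_le fun n => by
    rw [hC]; exact hnext _ _
  have hd : ∀ n, ∀ x ∈ (C (n + 1)).1, ∀ y ∈ (C (n + 1)).1, ‖x - y‖ ≤ (1 / 2) ^ n := fun n => by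
    rw [hC]; exact hdiam ⟨_, hpos n⟩ _
  have hpt : ∀ n, ∃ x, x ∈ (C n).1 := fun n => by
    obtain ⟨x, hx⟩ := (C n).2.2.2.2 Set.univ univ_mem
    exact ⟨x, hx.1⟩
  choose x hx using hpt
  -- The index starts at `n + 1` because `C 0 = K` carries no diameter bound.
  have hcauchy : CauchySeq fun n => x (n + 1) :=
    cauchySeq_of_le_geometric (1 / 2) 1 (by norm_num) fun n => by
      rw [one_mul, dist_eq_norm]
      exact hd n _ (hx (n + 1)) _ (hanti (Nat.le_succ (n + 1)) (hx (n + 2)))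
  obtain ⟨a, ha⟩ := cauchySeq_tendsto_of_complete hcauchy
  have hpow : Tendsto (fun n : ℕ => (1 / 2 : ℝ) ^ n) atTop (𝓝 0) :=
    tendsto_pow_atTop_nhds_zero_of_lt_one (by norm_num) (by norm_num)
  refine ⟨a, hKc.mem_of_tendsto ha (Eventually.of_forall fun n => (C _).2.2.2.1 (hx _)),
    fun A hA => ?_⟩
  -- Each `C n` also meets the hull of `A`; as the diameters shrink, such points converge to the
  -- same `a`.
  have hpt' : ∀ n, ∃ y, y ∈ (C n).1 ∧ y ∈ closedConvexHull ℝ A := fun n => (C n).2.2.2.2 A hA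
  choose y hy hyA using hpt'
  have hya : Tendsto (fun n => y (n + 1)) atTop (𝓝 a) := by
    have h0 : Tendsto (fun n => x (n + 1) - y (n + 1)) atTop (𝓝 0) :=
      squeeze_zero_norm (fun n => hd n _ (hx (n + 1)) _ (hy (n + 1))) hpow
    simpa using ha.sub h0
  exact isClosed_closedConvexHull.mem_of_tendsto hya (Eventually.of_forall fun n => hyA _)

/-- A closed half-space is its own closed convex hull, so one that misses `x` is not in `𝒱`, and its
complement is. -/
theorem tendsto_of_forall_mem_closedConvexHull {𝒱 : Ultrafilter E} {x : E}
    (hx : ∀ A ∈ 𝒱, x ∈ closedConvexHull ℝ A) (f : E →L[ℝ] ℝ) :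
    Tendsto f 𝒱 (𝓝 (f x)) := by
  refine tendsto_order.2 ⟨fun a ha => ?_, fun a ha => ?_⟩
  · by_contra hne
    have hA : {z | f z ≤ a} ∈ 𝒱 := by
      have := Ultrafilter.compl_mem_iff_notMem.2 hne
      simpa [Set.compl_def] using this
    have := closedConvexHull_min (𝕜 := ℝ) subset_rfl
      (by simpa using (f.toLinearMap.convexOn convex_univ).convex_le a)
      (isClosed_le f.continuous continuous_const) (hx _ hA)
    exact absurd this (not_le.2 ha)
  · by_contra hne
    have hA : {z | a ≤ f z} ∈ 𝒱 := by
      have := Ultrafilter.compl_mem_iff_notMem.2 hne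
      simpa [Set.compl_def] using this
    have := closedConvexHull_min (𝕜 := ℝ) subset_rfl
      (by simpa using (f.toLinearMap.concaveOn convex_univ).convex_ge a)
      (isClosed_le continuous_const f.continuous) (hx _ hA)
    exact absurd this (not_le.2 ha)

variable [Lattice E] [IsOrderedAddMonoid E] [IsOrderedModule ℝ E]

theorem convexOn_apply_posPart {f : E →L[ℝ] ℝ} (hf : ∀ x, 0 ≤ x → 0 ≤ f x) (p : E) :
    ConvexOn ℝ Set.univ fun z => f ((z - p) ⊔ 0) := by
  refine ⟨convex_univ, fun x _ y _ a b ha hb hab => ?_⟩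
  have : (a • x + b • y - p) ⊔ 0 ≤ a • ((x - p) ⊔ 0) + b • ((y - p) ⊔ 0) := by
    refine sup_le ?_ (add_nonneg (smul_nonneg ha le_sup_right) (smul_nonneg hb le_sup_right))
    calc a • x + b • y - p = a • (x - p) + b • (y - p) := by
          obtain rfl : b = 1 - a := by linarith
          module
      _ ≤ _ := add_le_add (smul_le_smul_of_nonneg_left le_sup_left ha)
          (smul_le_smul_of_nonneg_left le_sup_left hb)
  have h := monotone_of_nonneg hf this
  simpa using h

/-- The gap of the convex function `z ↦ ∑ f ((z - j e)⁺)` controls `f ((x - y)⁺)`. -/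
theorem apply_posPart_sub_le {f : E →L[ℝ] ℝ} (hf : ∀ x, 0 ≤ x → 0 ≤ f x) {e x y : E} {N : ℕ}
    (he : 0 ≤ e) (hx0 : 0 ≤ x) (hy0 : 0 ≤ y) (hx : x ≤ N • e) (hy : y ≤ N • e) :
    f ((x - y) ⊔ 0) ≤ 2 * f e + 2 * (∑ j ∈ Finset.range (N + 1), f ((x - j • e) ⊔ 0) +
      ∑ j ∈ Finset.range (N + 1), f ((y - j • e) ⊔ 0) -
      2 * ∑ j ∈ Finset.range (N + 1), f (((1 / 2 : ℝ) • (x + y) - j • e) ⊔ 0)) := by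
  set m := (1 / 2 : ℝ) • (x + y) with hm
  have h2m : x + y = (2 : ℝ) • m := by rw [hm, smul_smul]; norm_num
  -- `s j` is the part where `x` lies above level `j • e` and `y` below it. Since `(x - y) / 2 - |m
  -- - j • e|` is the meet of `x - j • e` and `j • e - y`, it is at most `S`, for every level `j`;
  -- and `m`, lying below `N • e`, has no excess.
  let s : ℕ → E := fun j => ((x - j • e) ⊓ -(y - j • e)) ⊔ 0
  let S : E := ∑ j ∈ Finset.range (N + 1), s j
  have hS0 : 0 ≤ S := Finset.sum_nonneg fun _ _ => le_sup_right
  have hkey : ∀ j ≤ N, (1 / 2 : ℝ) • (x - y) - S ≤ |m - j • e| := fun j hj => by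
    rw [sub_le_comm]
    refine le_trans ?_ (Finset.single_le_sum (f := s) (fun _ _ => le_sup_right)
      (Finset.mem_range.2 (Nat.lt_succ_of_le hj)))
    refine le_trans (le_inf ?_ ?_) le_sup_left
    · rw [sub_le_comm]
      have : (1 / 2 : ℝ) • (x - y) - (x - j • e) = -(m - j • e) := by
        rw [hm]; module
      rw [this]; exact neg_le_abs _
    · rw [sub_le_comm]
      have : (1 / 2 : ℝ) • (x - y) - -(y - j • e) = m - j • e := by
        rw [hm]; module
      rw [this]; exact le_abs_self _
  have hm0 : 0 ≤ m := smul_nonneg (by norm_num) (add_nonneg hx0 hy0)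
  have hmN : m ≤ N • e := by
    calc m ≤ (1 / 2 : ℝ) • (N • e + N • e) :=
          smul_le_smul_of_nonneg_left (add_le_add hx hy) (by norm_num)
      _ = N • e := by module
  have h1 := le_of_forall_le_abs_sub_nsmul he hm0 N hkey
  rw [sup_eq_right.2 (sub_nonpos.2 hmN), add_zero, sub_le_iff_le_add] at h1
  have h2 : (x - y) ⊔ 0 ≤ (2 : ℝ) • (e + S) := by
    refine sup_le ?_ (smul_nonneg (by norm_num) (add_nonneg he hS0))
    calc x - y = (2 : ℝ) • ((1 / 2 : ℝ) • (x - y)) := by rw [smul_smul]; norm_num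
      _ ≤ _ := smul_le_smul_of_nonneg_left h1 (by norm_num)
  have h3 := monotone_of_nonneg hf h2
  rw [map_smul, map_add, smul_eq_mul] at h3
  have h4 : f S ≤ ∑ j ∈ Finset.range (N + 1), f ((x - j • e) ⊔ 0) +
      ∑ j ∈ Finset.range (N + 1), f ((y - j • e) ⊔ 0) -
      2 * ∑ j ∈ Finset.range (N + 1), f ((m - j • e) ⊔ 0) := by
    rw [map_sum, Finset.mul_sum, ← Finset.sum_add_distrib, ← Finset.sum_sub_distrib]
    refine Finset.sum_le_sum fun j _ => ?_
    have h5 := monotone_of_nonneg hf (posPart_inf_neg_add_posPart_add_le (x - j • e) (y - j • e))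
    have h6 : x - j • e + (y - j • e) = (2 : ℝ) • (m - j • e) := by
      rw [smul_sub, ← h2m]; module
    rw [h6, smul_posPart_eq two_pos, map_add, map_add, map_smul, smul_eq_mul] at h5
    simp only [s]
    linarith
  linarith

/-- The functional `f` of `exists_functional` makes `z ↦ ∑ f ((z - j • e)⁺)`, with `e = v / N`,
uniformly convex up to `ε` on `[0, v]`. The common point of the hulls is then the weak limit of the
given ultrafilter. -/
theorem DisjointNullBelow.isCompact_Icc [HasSolidNorm E] [CompleteSpace E] {v : E} (hv : DisjointNullBelow v) :
    IsCompact (toWeakSpace ℝ E '' Set.Icc 0 v) := by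
  rcases em (0 ≤ v) with hv0 | hv0
  swap
  · rw [Set.Icc_eq_empty hv0, Set.image_empty]; exact isCompact_empty
  refine isCompact_iff_ultrafilter_le_nhds.2 fun 𝒰 h𝒰 => ?_
  let 𝒱 : Ultrafilter E := 𝒰.map (toWeakSpace ℝ E).symm
  have hK : Set.Icc 0 v ∈ (𝒱 : Filter E) := by
    refine mem_of_superset (le_principal_iff.1 h𝒰) ?_
    rintro _ ⟨z, hz, rfl⟩
    exact hz
  obtain ⟨x, hxK, hx⟩ := exists_mem_closedConvexHull_of_uniformConvex
    (isClosed_Icc : IsClosed (Set.Icc 0 v)) (convex_Icc 0 v) (fun ε hε => by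
      obtain ⟨f, hf, δ, hδ, hfδ⟩ := hv.exists_functional (half_pos hε)
      -- This gives `2 * f e ≤ δ / 2`; twice the gap `δ / 4` supplies the other half of `δ`.
      obtain ⟨N, hN⟩ := exists_nat_gt (4 * f v / δ)
      have hN0 : (0 : ℝ) < N := (div_nonneg (mul_nonneg (by norm_num) (hf v hv0)) hδ.le).trans_lt hN
      let e : E := (N : ℝ)⁻¹ • v
      have he : 0 ≤ e := smul_nonneg (by positivity) hv0
      have hNe : N • e = v := by
        simp only [e]
        rw [← Nat.cast_smul_eq_nsmul ℝ, smul_inv_smul₀ hN0.ne']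
      have hfe : 4 * f e ≤ δ := by
        simp only [e, map_smul, smul_eq_mul]
        rw [div_lt_iff₀ hδ] at hN
        rw [← mul_assoc, mul_comm 4, mul_assoc, inv_mul_le_iff₀ hN0]
        exact hN.le
      refine ⟨fun z => ∑ j ∈ Finset.range (N + 1), f ((z - j • e) ⊔ 0), by fun_prop, ?_,
        fun z => Finset.sum_nonneg fun j _ => hf _ le_sup_right,
        ⟨∑ j ∈ Finset.range (N + 1), f ((v - j • e) ⊔ 0), fun z hz => Finset.sum_le_sum fun j _ =>
          monotone_of_nonneg hf (sup_le_sup_right (sub_le_sub_right hz.2 _) _)⟩,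
        δ / 4, by positivity, fun x hx y hy hgap => ?_⟩
      · induction N + 1 with
        | zero => simpa using convexOn_const 0 convex_univ
        | succ k ih =>
          simp only [Finset.sum_range_succ]
          exact ih.add (convexOn_apply_posPart hf (k • e))
      · have hpos : ∀ x ∈ Set.Icc 0 v, ∀ y ∈ Set.Icc 0 v, f ((x - y) ⊔ 0) ≤ δ →
            ‖(x - y) ⊔ 0‖ ≤ ε / 2 := fun x hx y hy h =>
          hfδ _ le_sup_right ((sub_sup_zero_le hx.1 hy.1).trans hx.2) h
        have h1 := apply_posPart_sub_le hf he hx.1 hy.1 (hNe.symm ▸ hx.2) (hNe.symm ▸ hy.2)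
        have h2 := apply_posPart_sub_le hf he hy.1 hx.1 (hNe.symm ▸ hy.2) (hNe.symm ▸ hx.2)
        rw [add_comm y x] at h2
        have h3 := hpos x hx y hy (by linarith)
        have h4 := hpos y hy x hx (by linarith)
        have h5 : x - y = (x - y) ⊔ 0 - (y - x) ⊔ 0 := by
          rw [← neg_sub x y]; exact (posPart_sub_negPart (x - y)).symm
        rw [h5]
        exact (norm_sub_le _ _).trans (by linarith)) (𝒱 : Filter E) hK
  refine ⟨toWeakSpace ℝ E x, Set.mem_image_of_mem _ hxK, ?_⟩
  have h1 : Tendsto (fun z => toWeakSpace ℝ E z) 𝒱 (𝓝 (toWeakSpace ℝ E x)) :=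
    tendsto_toWeakSpace_iff.2 fun f => tendsto_of_forall_mem_closedConvexHull hx f
  have h2 : map (fun z => toWeakSpace ℝ E z) (𝒱 : Filter E) = 𝒰 := by
    simp only [𝒱, Ultrafilter.coe_map, Filter.map_map]
    exact Filter.map_id
  exact h2 ▸ h1

end WeakCompactness

/-! ### Relatively weakly compact intervals have null disjoint sequences. -/

section Interval

variable {E : Type*} [NormedAddCommGroup E] [NormedSpace ℝ E] [Lattice E] [IsOrderedAddMonoid E]
  [IsOrderedModule ℝ E] [HasSolidNorm E]

/-- Mazur: a norm closed convex set is weakly closed. -/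
theorem mem_of_mapClusterPt_toWeakSpace {E : Type*} [NormedAddCommGroup E] [NormedSpace ℝ E]
    {C : Set E} (hC : Convex ℝ C) (hCc : IsClosed C) {s : ℕ → E} (hs : ∀ᶠ n in atTop, s n ∈ C)
    {a : E} (ha : MapClusterPt (toWeakSpace ℝ E a) atTop fun n => toWeakSpace ℝ E (s n)) :
    a ∈ C := by
  have hcl : IsClosed (toWeakSpace ℝ E '' C) := by
    have := hC.toWeakSpace_closure (𝕜 := ℝ)
    rw [hCc.closure_eq] at this
    rw [this]; exact isClosed_closure
  have hmem : ∀ᶠ n in atTop, toWeakSpace ℝ E (s n) ∈ toWeakSpace ℝ E '' C :=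
    hs.mono fun n hn => Set.mem_image_of_mem _ hn
  obtain ⟨b, hb, hba⟩ := isClosed_iff_clusterPt.1 hcl _
    (ClusterPt.mono ha (le_principal_iff.2 (mem_map.2 hmem)))
  exact (toWeakSpace ℝ E).injective hba ▸ hb

/-- The partial sums increase inside `[0, v]`. A weak cluster point `a` is an upper bound of them
and lies in the norm closure of their convex hull; each convex combination is below some partial
sum, so they converge to `a` in norm and their increments are null. -/
theorem disjointNullBelow_of_isCompact {v : E}
    (hK : IsCompact (closure (toWeakSpace ℝ E '' Set.Icc 0 v))) : DisjointNullBelow v := by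
  intro y hy0 hyv hd
  have hv : 0 ≤ v := (hy0 0).trans (hyv 0)
  let s : ℕ → E := fun n => ∑ k ∈ Finset.range n, y k
  have hs : Monotone s := monotone_nat_of_le_succ fun n => by
    simp only [s, Finset.sum_range_succ]
    exact le_add_of_nonneg_right (hy0 n)
  have hsK : ∀ n, toWeakSpace ℝ E (s n) ∈ closure (toWeakSpace ℝ E '' Set.Icc 0 v) := fun n =>
    subset_closure ⟨s n, ⟨Finset.sum_nonneg fun k _ => hy0 k,
      sum_le_of_pairwise_inf_eq_zero _ hv hy0 hyv hd⟩, rfl⟩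
  obtain ⟨a', -, ha'⟩ := hK.exists_mapClusterPt (f := atTop) (u := fun n => toWeakSpace ℝ E (s n))
    (le_principal_iff.2 (mem_map.2 (Eventually.of_forall hsK)))
  obtain ⟨a, rfl⟩ := (toWeakSpace ℝ E).surjective a'
  have hle : ∀ n, s n ≤ a := fun n =>
    mem_of_mapClusterPt_toWeakSpace (convex_Ici (s n)) isClosed_Ici
      ((eventually_ge_atTop n).mono fun m hm => hs hm) ha'
  have hmem : a ∈ closure (convexHull ℝ (Set.range s)) :=
    mem_of_mapClusterPt_toWeakSpace (convex_convexHull ℝ _).closure isClosed_closure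
      (Eventually.of_forall fun n => subset_closure (subset_convexHull ℝ _ (Set.mem_range_self n))) ha'
  have hsub : convexHull ℝ (Set.range s) ⊆ {z | ∃ N, z ≤ s N} := by
    refine convexHull_min ?_ ?_
    · rintro _ ⟨N, rfl⟩; exact ⟨N, le_rfl⟩
    · rintro x ⟨N, hN⟩ z ⟨M, hM⟩ α β hα hβ hαβ
      exact ⟨max N M, convex_Iic (s (max N M)) (hN.trans (hs (le_max_left _ _)))
        (hM.trans (hs (le_max_right _ _))) hα hβ hαβ⟩
  have hsa : Tendsto s atTop (𝓝 a) := by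
    refine Metric.tendsto_atTop.2 fun ε hε => ?_
    obtain ⟨c, hc, hac⟩ := Metric.mem_closure_iff.1 hmem ε hε
    obtain ⟨N, hN⟩ := hsub hc
    refine ⟨N, fun n hn => ?_⟩
    rw [dist_comm, dist_eq_norm]
    rw [dist_eq_norm] at hac
    exact (norm_le_norm_of_nonneg_of_le (sub_nonneg.2 (hle n))
      (sub_le_sub_left (hN.trans (hs hn)) a)).trans_lt hac
  have hdiff : Tendsto (fun n => s (n + 1) - s n) atTop (𝓝 0) := by
    simpa using (hsa.comp (tendsto_add_atTop_nat 1)).sub hsa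
  have : Tendsto y atTop (𝓝 0) := hdiff.congr fun n => by
    simp only [s, Finset.sum_range_succ, add_sub_cancel_left]
  exact tendsto_zero_iff_norm_tendsto_zero.1 this

end Interval

/-! ### Lattice homomorphisms and the lifting of disjoint sequences. -/

section LatticeHomomorphism

variable {E : Type u} {F : Type v} [NormedAddCommGroup E] [NormedSpace ℝ E] [Lattice E]
  [NormedAddCommGroup F] [NormedSpace ℝ F] [Lattice F]

theorem IsLatticeHomomorphism.nonneg {T : E →ₗ[ℝ] F} (hT : IsLatticeHomomorphism T) {x : E}
    (hx : 0 ≤ x) : 0 ≤ T x := by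
  have := hT x 0
  rw [sup_eq_left.2 hx, map_zero] at this
  rw [this]; exact le_sup_right

theorem IsLatticeHomomorphism.map_abs {T : E →ₗ[ℝ] F} (hT : IsLatticeHomomorphism T) (x : E) :
    T |x| = |T x| := by
  rw [abs, abs, hT, map_neg]

variable [IsOrderedAddMonoid E] [IsOrderedAddMonoid F]

theorem IsLatticeHomomorphism.map_inf {T : E →ₗ[ℝ] F} (hT : IsLatticeHomomorphism T) (x y : E) :
    T (x ⊓ y) = T x ⊓ T y := by
  have h : x ⊓ y = -(-x ⊔ -y) := by rw [neg_sup, neg_neg, neg_neg]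
  rw [h, map_neg, hT, map_neg, map_neg, neg_sup, neg_neg, neg_neg]

/-- Any preimage `x` can be replaced by `|x| ⊓ u`. Order weak compactness of `T` thus becomes a
property of order intervals of `F`. -/
theorem IsLatticeHomomorphism.image_Icc {T : E →ₗ[ℝ] F} (hT : IsLatticeHomomorphism T)
    (hs : Function.Surjective T) {u : E} (hu : 0 ≤ u) :
    T '' Set.Icc 0 u = Set.Icc 0 (T u) := by
  ext y
  constructor
  · rintro ⟨x, hx, rfl⟩
    refine ⟨hT.nonneg hx.1, ?_⟩
    have := hT.nonneg (sub_nonneg.2 hx.2)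
    rwa [map_sub, sub_nonneg] at this
  · rintro ⟨h0, h1⟩
    obtain ⟨x, rfl⟩ := hs y
    refine ⟨|x| ⊓ u, ⟨le_inf (abs_nonneg x) hu, inf_le_right⟩, ?_⟩
    rw [hT.map_inf, hT.map_abs, abs_of_nonneg h0, inf_eq_left.2 h1]

/-- Disjoint sequences in `[0, T u]` are approximated by images of disjoint sequences. -/
theorem IsLatticeHomomorphism.disjointNullBelow [IsOrderedModule ℝ E]
    [IsOrderedModule ℝ F] [HasSolidNorm F] {T : E →ₗ[ℝ] F} (hT : IsLatticeHomomorphism T)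
    (hs : Function.Surjective T) {u : E} (hu : 0 ≤ u)
    (h : ∀ x : ℕ → E, DisjointSeq x → UnNull fun n => T (x n)) : DisjointNullBelow (T u) := by
  intro y hy0 hyv hd
  have hlift : ∀ n, ∃ a, (0 ≤ a ∧ a ≤ u) ∧ T a = y n := fun n => by
    have : y n ∈ T '' Set.Icc 0 u := hT.image_Icc hs hu ▸ ⟨hy0 n, hyv n⟩
    exact this
  choose a ha hay using hlift
  -- Subtracting `2 ^ n` times the earlier lifts, and `(2 ^ n)⁻¹ • u`, makes the lifts disjoint. In
  -- `F` the first subtraction costs nothing, as `T (S n)` is disjoint from `y n`; the second costs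
  -- `2 ^ (-n) * ‖T u‖`.
  let S : ℕ → E := fun n => ∑ i ∈ Finset.range n, (2 : ℝ) ^ n • a i
  have ht : ∀ n i, 0 ≤ (2 : ℝ) ^ n • a i := fun n i => smul_nonneg (by positivity) (ha i).1
  have hS0 : ∀ n, 0 ≤ S n := fun n => Finset.sum_nonneg fun i _ => ht n i
  have hp : ∀ n, 0 ≤ ((2 : ℝ) ^ n)⁻¹ • u := fun n => smul_nonneg (by positivity) hu
  let b : ℕ → E := fun n => (a n - S n - ((2 : ℝ) ^ n)⁻¹ • u) ⊔ 0
  have hb0 : ∀ n, 0 ≤ b n := fun n => le_sup_right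
  have hlt : ∀ i j, i < j → b j ⊓ b i = 0 := fun i j hij => by
    refine inf_eq_zero_of_le (hb0 j) (hb0 i) ?_ ?_
      (sub_smul_inf_sub_inv_smul_eq_zero (c := 2 ^ i) (one_le_pow₀ (by norm_num)) u (a i))
    · refine sup_le_sup_right ((sub_le_self _ (hp j)).trans (sub_le_sub (ha j).2 ?_)) 0
      refine le_trans (smul_le_smul_of_nonneg_right
        (pow_le_pow_right₀ (by norm_num) hij.le) (ha i).1) ?_
      exact Finset.single_le_sum (f := fun i => (2 : ℝ) ^ j • a i) (fun i _ => ht j i)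
        (Finset.mem_range.2 hij)
    · exact sup_le_sup_right (sub_le_sub_right (sub_le_self _ (hS0 i)) _) 0
  have hbd : DisjointSeq b := fun m n hmn => by
    rw [abs_of_nonneg (hb0 m), abs_of_nonneg (hb0 n)]
    rcases hmn.lt_or_gt with h | h
    · rw [inf_comm]; exact hlt m n h
    · exact hlt n m h
  have hTb0 : ∀ n, 0 ≤ T (b n) := fun n => hT.nonneg (hb0 n)
  have hTbu : ∀ n, T (b n) ≤ T u := fun n => by
    have h1 : b n ≤ u := by
      refine sup_le ?_ hu
      exact (sub_le_self _ (hp n)).trans ((sub_le_self _ (hS0 n)).trans (ha n).2)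
    have := hT.nonneg (sub_nonneg.2 h1)
    rwa [map_sub, sub_nonneg] at this
  have hnull := h b hbd (T u) (hT.nonneg hu)
  have hyle : ∀ n, ‖y n‖ ≤ ‖|T (b n)| ⊓ T u‖ + (1 / 2) ^ n * ‖T u‖ := fun n => by
    rw [abs_of_nonneg (hTb0 n), inf_eq_left.2 (hTbu n)]
    have hST : y n ⊓ T (S n) = 0 := by
      simp only [S, map_sum]
      refine inf_sum_eq_zero _ (hy0 n) (fun i => hT.nonneg (ht n i)) fun i hi => ?_
      have hni : n ≠ i := (Finset.mem_range.1 hi).ne'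
      -- The scalar `2 ^ n` is written as a sum of `2 ^ n` copies, so that `inf_sum_eq_zero`
      -- applies.
      rw [map_smul, hay, ← Nat.cast_two, ← Nat.cast_pow, Nat.cast_smul_eq_nsmul,
        ← Finset.card_range (2 ^ n), ← Finset.sum_const]
      exact inf_sum_eq_zero _ (hy0 n) (fun _ => hy0 i) fun _ _ => hd n i hni
    have h1 : (y n - T (S n)) ⊔ 0 = y n := by
      have := sub_inf (y n) (T (S n)) (y n)
      rwa [hST, sub_zero, sub_self, sup_comm, eq_comm] at this
    have h2 : y n ≤ T (b n) + ((2 : ℝ) ^ n)⁻¹ • T u := by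
      have hr : 0 ≤ ((2 : ℝ) ^ n)⁻¹ • T u := smul_nonneg (by positivity) (hT.nonneg hu)
      have hTb : T (b n) = (y n - T (S n) - ((2 : ℝ) ^ n)⁻¹ • T u) ⊔ 0 := by
        rw [hT, map_sub, map_sub, map_smul, map_zero, hay]
      calc y n = (y n - T (S n)) ⊔ 0 := h1.symm
        _ ≤ T (b n) + ((2 : ℝ) ^ n)⁻¹ • T u :=
          sup_le (hTb ▸ le_posPart_sub_add) (add_nonneg (hTb0 n) hr)
    refine (norm_le_norm_of_nonneg_of_le (hy0 n) h2).trans ((norm_add_le _ _).trans ?_)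
    rw [norm_smul, Real.norm_of_nonneg (by positivity), one_div, inv_pow]
  have hpow : Tendsto (fun n : ℕ => (1 / 2 : ℝ) ^ n) atTop (𝓝 0) :=
    tendsto_pow_atTop_nhds_zero_of_lt_one (by norm_num) (by norm_num)
  refine squeeze_zero (fun n => norm_nonneg _) hyle ?_
  simpa using hnull.add (hpow.mul_const ‖T u‖)

end LatticeHomomorphism

/-! ### Automatic continuity of positive maps. -/

section Operators

variable {E : Type u} {F : Type v}
  [NormedAddCommGroup E] [NormedSpace ℝ E] [Lattice E] [IsOrderedAddMonoid E]
  [IsOrderedModule ℝ E] [HasSolidNorm E]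
  [NormedAddCommGroup F] [NormedSpace ℝ F] [Lattice F] [IsOrderedAddMonoid F]
  [HasSolidNorm F]

/-- Positive linear maps on a Banach lattice are continuous. -/
theorem exists_continuousLinearMap_of_nonneg [CompleteSpace E] (T : E →ₗ[ℝ] F)
    (hT : ∀ x, 0 ≤ x → 0 ≤ T x) : ∃ S : E →L[ℝ] F, ∀ x, S x = T x := by
  have hmono : ∀ x y, x ≤ y → T x ≤ T y := fun x y h => by
    have := hT _ (sub_nonneg.2 h)
    rwa [map_sub, sub_nonneg] at this
  obtain ⟨n, hn⟩ : ∃ n : ℕ, ∀ x, 0 ≤ x → ‖T x‖ ≤ 4 ^ n * ‖x‖ := by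
    by_contra! hcon
    choose x hx0 hx using hcon
    have hpos : ∀ n, 0 < ‖x n‖ := fun n => norm_pos_iff.2 fun h => by
      have := hx n
      simp [h] at this
    -- Rescaled to norm `2 ^ (-n)`, the `x n` are summable with images of norm at least `2 ^ n`; the
    -- sum dominates each term, so its image would have infinite norm.
    let c : ℕ → ℝ := fun n => (2 ^ n * ‖x n‖)⁻¹
    have hc : ∀ n, 0 < c n := fun n => inv_pos.2 (mul_pos (by positivity) (hpos n))
    have hz : ∀ n, ‖c n • x n‖ ≤ (1 / 2) ^ n := fun n => by
      rw [norm_smul, Real.norm_of_nonneg (hc n).le]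
      simp only [c]
      rw [mul_inv, mul_assoc, inv_mul_cancel₀ (hpos n).ne', mul_one, one_div, inv_pow]
    have hsum : Summable fun n => c n • x n :=
      Summable.of_norm_bounded summable_geometric_two hz
    have hle : ∀ n, (2 : ℝ) ^ n ≤ ‖T (∑' n, c n • x n)‖ := fun n => by
      have h0 : ∀ n, 0 ≤ c n • x n := fun n => smul_nonneg (hc n).le (hx0 n)
      refine le_trans ?_ (norm_le_norm_of_nonneg_of_le (hT _ (h0 n))
        (hmono _ _ (hsum.le_tsum n fun j _ => h0 j)))
      rw [map_smul, norm_smul, Real.norm_of_nonneg (hc n).le]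
      simp only [c]
      rw [le_inv_mul_iff₀ (mul_pos (by positivity) (hpos n))]
      calc 2 ^ n * ‖x n‖ * 2 ^ n = 4 ^ n * ‖x n‖ := by
            rw [show (4 : ℝ) = 2 * 2 by norm_num, mul_pow]; ring
        _ ≤ _ := (hx n).le
    obtain ⟨n, hn⟩ := pow_unbounded_of_one_lt ‖T (∑' n, c n • x n)‖ (one_lt_two (α := ℝ))
    exact absurd (hle n) (not_le.2 hn)
  refine ⟨T.mkContinuous (4 ^ n) fun x => ?_, fun x => rfl⟩
  have habs : |T x| ≤ T |x| := abs_le'.2 ⟨hmono _ _ (le_abs_self x), by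
    rw [← map_neg]; exact hmono _ _ (neg_le_abs x)⟩
  calc ‖T x‖ ≤ ‖T |x|‖ :=
        norm_le_norm_of_abs_le_abs (habs.trans (le_abs_self _))
    _ ≤ 4 ^ n * ‖|x|‖ := hn _ (abs_nonneg x)
    _ = 4 ^ n * ‖x‖ := by rw [norm_abs_eq_norm]

end Operators

/-! ### Order continuity and the two equivalences. -/

section Sequences

variable {E : Type u} [NormedAddCommGroup E] [NormedSpace ℝ E] [Lattice E] [IsOrderedAddMonoid E]
  [IsOrderedModule ℝ E] [HasSolidNorm E]

theorem DisjointSeq.uawNull {x : ℕ → E} (hx : DisjointSeq x) : UawNull x := fun _ hu =>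
  tendsto_toWeakSpace_zero_iff.2 <| tendsto_apply_of_disjoint
    (fun n => le_inf (abs_nonneg (x n)) hu) (fun _ => inf_le_right) fun m n hmn =>
      inf_eq_zero_of_le (le_inf (abs_nonneg _) hu) (le_inf (abs_nonneg _) hu) inf_le_left
        inf_le_left (hx m n hmn)

theorem UnNull.uawNull {E : Type u} [NormedAddCommGroup E] [NormedSpace ℝ E] [Lattice E]
    {x : ℕ → E} (hx : UnNull x) : UawNull x := fun _ hu =>
  tendsto_toWeakSpace_zero_iff.2 fun f => by
    simpa [Function.comp_def] using
      (f.continuous.tendsto 0).comp (tendsto_zero_iff_norm_tendsto_zero.2 (hx _ hu))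

theorem disjointNullBelow_of_unNull {E : Type u} [NormedAddCommGroup E] [Lattice E]
    [IsOrderedAddMonoid E] (h : ∀ x : ℕ → E, DisjointSeq x → UnNull x) (v : E) :
    DisjointNullBelow v := fun y hy0 hyv hd => by
  have hdis : DisjointSeq y := fun m n hmn => by
    rw [abs_of_nonneg (hy0 m), abs_of_nonneg (hy0 n), hd m n hmn]
  refine (h y hdis v ((hy0 0).trans (hyv 0))).congr fun n => ?_
  rw [abs_of_nonneg (hy0 n), inf_eq_left.2 (hyv n)]

/-- The Archimedean property, from `c ≤ b / (k + 1)` and closedness of the order. -/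
theorem nonpos_of_forall_nsmul_le {b c : E} (h : ∀ k : ℕ, k • c ≤ b) : c ≤ 0 := by
  have h0 : Tendsto (fun k : ℕ => ((k : ℝ) + 1)⁻¹ • b) atTop (𝓝 ((0 : ℝ) • b)) :=
    (tendsto_inv_atTop_zero.comp
      (tendsto_atTop_add_const_right _ 1 tendsto_natCast_atTop_atTop)).smul_const b
  rw [zero_smul] at h0
  refine ge_of_tendsto' h0 fun k => ?_
  rw [le_inv_smul_iff_of_pos (by positivity)]
  exact_mod_cast (Nat.cast_smul_eq_nsmul ℝ (k + 1) c).le.trans (h (k + 1))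

/-- The partial sums `s n` need not have a supremum, so the net runs over all differences of an
upper bound `b` and an `s n`. If `c` is below every difference, then `b - c` is again an upper
bound, hence so is every `b - k • c`, and `c ≤ 0`. Finally `y n ≤ b - s n`, as `s (n + 1) ≤ b`. -/
theorem OrderContinuousNorm.disjointNullBelow (h : OrderContinuousNorm E) (v : E) :
    DisjointNullBelow v := by
  intro y hy0 hyv hd
  have hv : 0 ≤ v := (hy0 0).trans (hyv 0)
  let s : ℕ → E := fun n => ∑ k ∈ Finset.range n, y k
  have hs : Monotone s := monotone_nat_of_le_succ fun n => by
    simp only [s, Finset.sum_range_succ]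
    exact le_add_of_nonneg_right (hy0 n)
  let U := {b : E // ∀ n, s n ≤ b}
  have : Nonempty U := ⟨⟨v, fun n => sum_le_of_pairwise_inf_eq_zero _ hv hy0 hyv hd⟩⟩
  have : IsDirected (Uᵒᵈ × ℕ) (· ≤ ·) := ⟨fun p q =>
    ⟨(OrderDual.toDual ⟨(OrderDual.ofDual p.1).1 ⊓ (OrderDual.ofDual q.1).1,
        fun n => le_inf ((OrderDual.ofDual p.1).2 n) ((OrderDual.ofDual q.1).2 n)⟩, max p.2 q.2),
      ⟨(inf_le_left : _ ≤ (OrderDual.ofDual p.1).1), le_max_left _ _⟩,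
      ⟨(inf_le_right : _ ≤ (OrderDual.ofDual q.1).1), le_max_right _ _⟩⟩⟩
  let x : Uᵒᵈ × ℕ → E := fun p => (OrderDual.ofDual p.1).1 - s p.2
  have hx : Antitone x := fun p q hpq => sub_le_sub hpq.1 (hs hpq.2)
  have hglb : IsGLB (Set.range x) 0 := by
    refine ⟨?_, fun c hc => ?_⟩
    · rintro _ ⟨p, rfl⟩
      exact sub_nonneg.2 ((OrderDual.ofDual p.1).2 _)
    · obtain ⟨b⟩ := ‹Nonempty U›
      have hk : ∀ k n : ℕ, s n ≤ b.1 - k • c := fun k => by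
        induction k with
        | zero => simpa using b.2
        | succ k ih =>
          intro n
          have : c ≤ b.1 - k • c - s n := hc ⟨(OrderDual.toDual ⟨_, ih⟩, n), rfl⟩
          rw [le_sub_comm] at this
          rwa [succ_nsmul, ← sub_sub]
      refine nonpos_of_forall_nsmul_le (b := b.1) fun k => ?_
      have : (0 : E) ≤ b.1 - k • c := by simpa [s] using hk k 0
      exact sub_nonneg.1 this
  have hlim := h (Uᵒᵈ × ℕ) x hx hglb
  refine Metric.tendsto_atTop.2 fun ε hε => ?_
  obtain ⟨⟨b, N⟩, hN⟩ := eventually_atTop.1 (hlim.eventually_lt_const hε)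
  refine ⟨N, fun n hn => ?_⟩
  have h1 := hN (b, n) ⟨le_rfl, hn⟩
  have h2 : y n ≤ x (b, n) := by
    have := (OrderDual.ofDual b).2 (n + 1)
    simp only [s, Finset.sum_range_succ] at this
    exact le_sub_iff_add_le'.2 this
  simpa using (norm_le_norm_of_nonneg_of_le (hy0 n) h2).trans_lt h1

variable [CompleteSpace E]

theorem orderContinuousNorm_of_disjointNullBelow (h : ∀ v : E, DisjointNullBelow v) :
    OrderContinuousNorm E := by
  intro ι _ _ _ x hx hglb
  have hx0 : ∀ i, 0 ≤ x i := fun i => hglb.1 ⟨i, rfl⟩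
  let i₀ : ι := Classical.arbitrary ι
  -- Meeting with `x i₀` makes the net order bounded and changes nothing beyond `i₀`.
  obtain ⟨a, ha⟩ := (h (x i₀)).exists_tendsto_of_antitone
    (x := fun i => x i ⊓ x i₀) (fun i j hij => inf_le_inf_right _ (hx hij))
    (fun i => le_inf (hx0 i) (hx0 i₀)) fun i => inf_le_right
  have hev : Tendsto x atTop (𝓝 a) := ha.congr' <| by
    filter_upwards [eventually_ge_atTop i₀] with i hi
    exact inf_eq_left.2 (hx hi)
  have ha0 : a = 0 := by
    refine le_antisymm (hglb.2 ?_) (ge_of_tendsto' hev hx0)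
    rintro _ ⟨i, rfl⟩
    exact le_of_tendsto hev ((eventually_ge_atTop i).mono fun j hj => hx hj)
  rw [ha0] at hev
  exact tendsto_zero_iff_norm_tendsto_zero.1 hev

theorem tfae_of_surjective_latticeHomomorphism {F : Type v}
    [NormedAddCommGroup F] [NormedSpace ℝ F] [CompleteSpace F]
    [Lattice F] [IsOrderedAddMonoid F] [IsOrderedModule ℝ F] [HasSolidNorm F]
    (T : E →ₗ[ℝ] F) (hT : IsLatticeHomomorphism T) (hs : Function.Surjective T) :
    List.TFAE
      [∀ x : ℕ → E, UawNull x → UnNull (fun n => T (x n)),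
       ∀ x : ℕ → E, DisjointSeq x → UnNull (fun n => T (x n)),
       OrderWeaklyCompact T] := by
  tfae_have 1 → 2 := fun h x hx => h x hx.uawNull
  tfae_have 2 → 3 := fun h u hu => by
    rw [hT.image_Icc hs hu]
    have hc := (hT.disjointNullBelow hs hu h).isCompact_Icc
    -- The interval is convex and norm closed, hence weakly closed.
    have hcl : IsClosed (toWeakSpace ℝ F '' Set.Icc 0 (T u)) := by
      have := (convex_Icc 0 (T u)).toWeakSpace_closure (𝕜 := ℝ)
      rw [isClosed_Icc.closure_eq] at this
      rw [this]; exact isClosed_closure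
    rwa [hcl.closure_eq]
  tfae_have 3 → 1 := fun h x hx w hw => by
    obtain ⟨S, hS⟩ := exists_continuousLinearMap_of_nonneg T fun _ => hT.nonneg
    obtain ⟨u, rfl⟩ := hs w
    have hTu : T |u| = T u := by rw [hT.map_abs, abs_of_nonneg hw]
    have hu := h |u| (abs_nonneg u)
    rw [hT.image_Icc hs (abs_nonneg u), hTu] at hu
    refine (disjointNullBelow_of_isCompact hu).tendsto_of_weakly_null
      (fun n => le_inf (abs_nonneg _) hw) (fun n => inf_le_right) fun f => ?_
    -- Continuity of the positive map `T` lets `f` be pulled back to a functional on `E`.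
    have := tendsto_toWeakSpace_zero_iff.1 (hx |u| (abs_nonneg u)) (f.comp S)
    refine this.congr fun n => ?_
    rw [ContinuousLinearMap.comp_apply, hS, hT.map_inf, hT.map_abs, hTu]
  tfae_finish

theorem tfae_orderContinuousNorm :
    List.TFAE
      [∀ x : ℕ → E, UawNull x ↔ UnNull x,
       ∀ x : ℕ → E, DisjointSeq x → UnNull x,
       OrderContinuousNorm E] := by
  tfae_have 1 → 2 := fun h x hx => (h x).1 hx.uawNull
  tfae_have 2 → 3 := fun h =>
    orderContinuousNorm_of_disjointNullBelow (disjointNullBelow_of_unNull h)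
  tfae_have 3 → 1 := fun h x => ⟨fun hx u hu =>
    (h.disjointNullBelow u).tendsto_of_weakly_null (fun n => le_inf (abs_nonneg _) hu)
      (fun n => inf_le_right) (tendsto_toWeakSpace_zero_iff.1 (hx u hu)), fun hx => hx.uawNull⟩
  tfae_finish

end Sequences

theorem mainTheorem11 {E : Type u}
    [NormedAddCommGroup E] [NormedSpace ℝ E] [CompleteSpace E]
    [Lattice E] [IsOrderedAddMonoid E] [IsOrderedModule ℝ E] [HasSolidNorm E] :
    (∀ {F : Type v}
      [NormedAddCommGroup F] [NormedSpace ℝ F] [CompleteSpace F]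
      [Lattice F] [IsOrderedAddMonoid F] [IsOrderedModule ℝ F] [HasSolidNorm F]
      (T : E →ₗ[ℝ] F), IsLatticeHomomorphism T → Function.Surjective T →
      List.TFAE
        [∀ x : ℕ → E, UawNull x → UnNull (fun n => T (x n)),
         ∀ x : ℕ → E, DisjointSeq x → UnNull (fun n => T (x n)),
         OrderWeaklyCompact T]) ∧
    List.TFAE
      [∀ x : ℕ → E, UawNull x ↔ UnNull x,
       ∀ x : ℕ → E, DisjointSeq x → UnNull x,
       OrderContinuousNorm E] :=
  ⟨fun T hT hs => tfae_of_surjective_latticeHomomorphism T hT hs, tfae_orderContinuousNorm⟩
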